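/- Let $0<q<1$ and $a>0$, and let $\mathcal A^*_{q,a}=\{\pm aq^n : n\in\mathbb N_0\}\cup\{0\}$. Write $D_qf(x)=\frac{f(x)-f(qx)}{(1-q)x}$ for $x\ne0$ and $D_qf(0)=\lim_{n\to\infty}\frac{f(xq^n)-f(0)}{xq^n}$ (when this limit exists for every $x\neq 0$ and does not depend on $x$), $$\int_0^t f\,d_qx=(1-q)t\sum_{n\ge0}q^nf(tq^n)\quad(t\in\mathbb R),\qquad \int_{-a}^{a}f\,d_qx=\int_0^af\,d_qx-\int_0^{-a}f\,d_qx,$$ and $$S_q(z)=\sum_{n=0}^{\infty}(-1)^n\frac{q^{n(n+1/2)}z^{2n+1}}{(q;q)_{2n+1}},\qquad (q;q)_m=\prod_{j=1}^m(1-q^j).$$ A sequence $f_n$ converges to $f$ in $q$-mean if the $q$-integrals $\int_{-a}^a|f_n-f|^2\,d_qx$ converge and $\lim_{n\to\infty}\big(\int_{-a}^a|f_n(x)-f(x)|^2\,d_qx\big)^{1/2}=0$. The positive zeros of $S_q$ form an infinite strictly increasing sequence $w_1<w_2<\cdots$, and the following holds. Let $g$ be a real-valued function defined on $\mathcal A^*_{q,a}$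 and on a neighborhood of $0$ in $\mathbb R$ such that * $g$ is $q$-regular at zero on $\mathcal A^*_{q,a}$, i.e. $\lim_{n\to\infty}g(xq^n)=g(0)$ for all $x\in\mathcal A^*_{q,a}$; * $g$ is odd on $\mathcal A^*_{q,a}$; * each of $g$, $D_qg$, $D_q^2g$ is continuous and piecewise smooth in a neighborhood of $0$ (piecewise smooth: continuously differentiable except at finitely many points, with finite one-sided limits of the derivative everywhere in the neighborhood); * $g(0)=g(a)=0$. Then there are real numbers $c_1,c_2,\dots$ (depending on $g$, but not on $n$) such that, with $$g_n(x)=\sum_{r=1}^{n}c_r\,S_q\!\left(\frac{w_rx}{a}\right),$$ for each $k\in\{0,1,2\}$ the sequence $D_q^kg_n$ converges in $q$-mean to $D_q^kg$. -/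

import Mathlib

open Filter Topology

noncomputable section

namespace QFourier

/-- The `q`-shifted factorial `(b; q)_n = ∏_{k < n} (1 - b q^k)`. -/
def qShifted (b q : ℝ) (n : ℕ) : ℝ :=
  ∏ k ∈ Finset.range n, (1 - b * q ^ k)

/-- The `q`-sine function
`S_q(z) = ∑_{n ≥ 0} (-1)^n q^{n(n+1/2)} z^{2n+1} / (q; q)_{2n+1}` on the real line. -/
def qSin (q z : ℝ) : ℝ :=
  ∑' n : ℕ, (-1) ^ n * q ^ ((n : ℝ) * ((n : ℝ) + 1 / 2)) * z ^ (2 * n + 1)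
    / qShifted q q (2 * n + 1)

/-- The two-sided grid `{±a q^n : n ∈ ℕ} ∪ {0}`. -/
def grid (q a : ℝ) : Set ℝ :=
  {x | x = 0 ∨ ∃ n : ℕ, x = a * q ^ n ∨ x = -(a * q ^ n)}

/-- `f` is `q`-regular at zero on `X`: `f (x q^n) → f 0` for every `x ∈ X`. -/
def QRegularAtZero (q : ℝ) (X : Set ℝ) (f : ℝ → ℝ) : Prop :=
  ∀ x ∈ X, Tendsto (fun n : ℕ => f (x * q ^ n)) atTop (𝓝 (f 0))

/-- `L` is the `q`-derivative of `f` at zero: `(f (x q^n) - f 0) / (x q^n) → L` for every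
`x ≠ 0`, with a limit that does not depend on `x`. -/
def HasQDerivAtZero (q : ℝ) (f : ℝ → ℝ) (L : ℝ) : Prop :=
  ∀ x : ℝ, x ≠ 0 → Tendsto (fun n : ℕ => (f (x * q ^ n) - f 0) / (x * q ^ n)) atTop (𝓝 L)

open Classical in
/-- Jackson's `q`-difference operator: `D_q f (x) = (f x - f (q x)) / ((1 - q) x)` for `x ≠ 0`,
and `D_q f (0)` is the `q`-derivative at zero (with the value `0` where that does not exist). -/
def qDeriv (q : ℝ) (f : ℝ → ℝ) (x : ℝ) : ℝ :=
  if x = 0 then (if h : ∃ L, HasQDerivAtZero q f L then h.choose else 0)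
  else (f x - f (q * x)) / ((1 - q) * x)

/-- Jackson's `q`-integral over `[0, t]` exists: the series that defines it converges
absolutely. -/
def QIntegrable (q t : ℝ) (f : ℝ → ℝ) : Prop :=
  Summable (fun n : ℕ => q ^ n * f (t * q ^ n))

/-- Jackson's `q`-integral `∫_0^t f d_q x = (1 - q) t ∑_{n ≥ 0} q^n f (t q^n)`
(`t` may be negative). -/
def qIntegralZero (q t : ℝ) (f : ℝ → ℝ) : ℝ :=
  (1 - q) * t * ∑' n : ℕ, q ^ n * f (t * q ^ n)

/-- Jackson's `q`-integral `∫_s^t f d_q x = ∫_0^t f d_q x - ∫_0^s f d_q x`. -/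
def qIntegral (q s t : ℝ) (f : ℝ → ℝ) : ℝ :=
  qIntegralZero q t f - qIntegralZero q s f

/-- `F n → f` in `q`-mean on the grid: the `q`-integrals `∫_{-a}^a |F n - f|^2 d_q x` exist
and their square roots tend to zero. -/
def TendstoQMean (q a : ℝ) (F : ℕ → ℝ → ℝ) (f : ℝ → ℝ) : Prop :=
  (∀ n, QIntegrable q a (fun x => |F n x - f x| ^ 2) ∧
    QIntegrable q (-a) (fun x => |F n x - f x| ^ 2)) ∧
  Tendsto (fun n => √(qIntegral q (-a) a (fun x => |F n x - f x| ^ 2))) atTop (𝓝 0)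

/-- `f` is piecewise smooth on the open set `U`: off a finite set of points it is continuously
differentiable, and at every point of `U` the derivative has finite one-sided limits. -/
def PiecewiseSmoothOn (f : ℝ → ℝ) (U : Set ℝ) : Prop :=
  ∃ s : Finset ℝ,
    (∀ x ∈ U, x ∉ s → DifferentiableAt ℝ f x ∧ ContinuousAt (deriv f) x) ∧
    ∀ x ∈ U, (∃ L, Tendsto (deriv f) (𝓝[>] x) (𝓝 L)) ∧
      (∃ L, Tendsto (deriv f) (𝓝[<] x) (𝓝 L))

/-- `f` is continuous and piecewise smooth in a neighborhood of zero. -/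
def ContinuousPiecewiseSmoothNearZero (f : ℝ → ℝ) : Prop :=
  ∃ δ : ℝ, 0 < δ ∧ ContinuousOn f (Set.Ioo (-δ) δ) ∧ PiecewiseSmoothOn f (Set.Ioo (-δ) δ)

end QFourier

end

/-! On the grid `a q^n` a function becomes a sequence, and a second-order `q`-difference equation
becomes a three-term recurrence. The sequence `S_q(z q^n)` solves the recurrence with parameter `τ =
z²/√q`. It decays like `q^n`, and a Casoratian argument shows that such a solution is unique up to
scaling. A solution that decays and also vanishes at `n = 0` therefore exists exactly when `S_q(z) =
0`.

The second difference with these two boundary conditions is inverted by an explicit Green kernel.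
Weighted by powers of `√q`, the kernel gives a compact symmetric operator on `ℓ²`. Its eigenvectors
are the sine vectors at the positive zeros of `S_q`, with eigenvalues `√q / z²`
(`green_apply_sineVector`, `green_eigenvector`). The spectral theorem makes them an orthogonal basis
(`exists_sine_basis`). Infinite dimension gives infinitely many zeros, and compactness leaves
finitely many below any bound.

The function expanded in this basis is `D_q² g`, not `g`. Since `D_q²` sends a sine mode to a
multiple of the same mode one grid step further in, dividing the coefficients by `-w_r²` gives
`c_r`, and convergence of second derivatives is immediate. Convergence for `k = 0, 1` follows from a
Poincaré-type inequality, `gridDiff_bounds`, which uses the zero boundary values. No decay estimate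
for the coefficients is needed. -/

namespace QFourier

/-! ### Compact symmetric operators on `ℓ²` -/

/-- The real Hilbert space `ℓ²(ℕ)`. -/
abbrev EllTwo : Type := lp (fun _ : ℕ => ℝ) 2

theorem EllTwo.memℓp_of_summable_sq {x : ℕ → ℝ} (hx : Summable fun n => x n ^ 2) :
    Memℓp x 2 := by
  refine memℓp_gen ?_
  simpa using hx

theorem EllTwo.summable_sq (x : EllTwo) : Summable fun n => x n ^ 2 := by
  simpa [sq] using lp.summable_inner (𝕜 := ℝ) x x

theorem EllTwo.norm_sq (x : EllTwo) : ‖x‖ ^ 2 = ∑' n, x n ^ 2 := by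
  rw [← real_inner_self_eq_norm_sq, lp.inner_eq_tsum]
  simp [sq]

theorem EllTwo.inner_eq (x y : EllTwo) : inner ℝ x y = ∑' n, x n * y n := by
  rw [lp.inner_eq_tsum]
  simp [mul_comm]

theorem EllTwo.summable_mul (x y : EllTwo) : Summable fun n => x n * y n := by
  simpa [mul_comm] using lp.summable_inner (𝕜 := ℝ) x y

/-- A geometrically bounded sequence as an element of `ℓ²`, with a bound for its norm. -/
theorem EllTwo.exists_of_geometric_bound {r C : ℝ} (hr0 : 0 ≤ r) (hr1 : r < 1) (hC : 0 ≤ C)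
    {x : ℕ → ℝ} (hx : ∀ n, |x n| ≤ C * r ^ n) :
    ∃ y : EllTwo, (∀ n, y n = x n) ∧ ‖y‖ ≤ C / (1 - r) := by
  have hle : ∀ n, |x n| ^ 2 ≤ C ^ 2 * (r ^ 2) ^ n := fun n => by
    calc |x n| ^ 2 ≤ (C * r ^ n) ^ 2 := pow_le_pow_left₀ (abs_nonneg _) (hx n) 2
      _ = _ := by rw [mul_pow, ← pow_mul, ← pow_mul, mul_comm n 2]
  have hr2 : r ^ 2 < 1 := by nlinarith
  have hg : HasSum (fun n => C ^ 2 * (r ^ 2) ^ n) (C ^ 2 * (1 - r ^ 2)⁻¹) :=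
    (hasSum_geometric_of_lt_one (sq_nonneg r) hr2).mul_left _
  have hs : Summable fun n => x n ^ 2 :=
    Summable.of_nonneg_of_le (fun n => sq_nonneg _) (fun n => by simpa using hle n) hg.summable
  refine ⟨⟨x, EllTwo.memℓp_of_summable_sq hs⟩, fun n => rfl, ?_⟩
  have h1 : 0 < 1 - r := by linarith
  refine abs_le_of_sq_le_sq' ?_ (by positivity) |>.2
  rw [EllTwo.norm_sq]
  calc ∑' n, x n ^ 2 ≤ C ^ 2 * (1 - r ^ 2)⁻¹ := by
        rw [← hg.tsum_eq]
        exact hs.tsum_le_tsum (fun n => by simpa using hle n) hg.summable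
    _ ≤ C ^ 2 * ((1 - r) ^ 2)⁻¹ := by
        gcongr
        nlinarith
    _ = (C / (1 - r)) ^ 2 := by rw [div_pow, div_eq_mul_inv]

/-- A symmetric kernel with absolutely summable rows defines a compact symmetric operator. -/
theorem EllTwo.exists_compact_operator (A : ℕ → EllTwo) (hA : Summable fun i => ‖A i‖)
    (hsymm : ∀ i j, A i j = A j i) :
    ∃ K : EllTwo →L[ℝ] EllTwo, (∀ x i, K x i = inner ℝ (A i) x) ∧
      IsCompactOperator K ∧ (K : EllTwo →ₗ[ℝ] EllTwo).IsSymmetric := by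
  let e : ℕ → EllTwo := fun i => lp.single 2 i (1 : ℝ)
  have he : ∀ i, ‖e i‖ = 1 := fun i => by simp [e]
  -- The operator is a norm-convergent sum of rank-one operators, one per row; compactness follows
  -- because finite-rank partial sums converge to it.
  let R : ℕ → EllTwo →L[ℝ] EllTwo := fun i => (innerSL ℝ (A i)).smulRight (e i)
  have hRn : ∀ i, ‖R i‖ ≤ ‖A i‖ := fun i => by
    simp only [R, ContinuousLinearMap.norm_smulRight_apply, he, mul_one, innerSL_apply_norm]
    exact le_rfl
  have hR : Summable R := Summable.of_norm_bounded hA hRn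
  have hRapp : ∀ x i, R i x = inner ℝ (A i) x • e i := fun x i => rfl
  have hcoord : ∀ (x : EllTwo) (i : ℕ), x i = inner ℝ (e i) x := fun x i => by
    simp [e, lp.inner_single_left]
  have hK : ∀ x i, (∑' i, R i) x i = inner ℝ (A i) x := by
    intro x j
    have h1 : HasSum (fun i => R i x) ((∑' i, R i) x) :=
      hR.hasSum.mapL (ContinuousLinearMap.apply ℝ EllTwo x)
    have h2 : HasSum (fun i => inner ℝ (e j) (R i x)) (inner ℝ (e j) ((∑' i, R i) x)) :=
      h1.mapL (innerSL ℝ (e j))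
    rw [hcoord, ← h2.tsum_eq, tsum_eq_single j]
    · rw [hRapp, ← hcoord]; simp [e]
    · intro i hi
      rw [hRapp, ← hcoord]
      simp [e, lp.single_apply, Ne.symm hi]
  refine ⟨∑' i, R i, hK, ?_, ?_⟩
  · refine isCompactOperator_of_tendsto (F := fun s : Finset ℕ => ∑ i ∈ s, R i) (l := atTop)
      hR.hasSum (Eventually.of_forall fun s => ?_)
    refine Submodule.sum_mem (compactOperator (RingHom.id ℝ) EllTwo EllTwo) fun i _ => ?_
    have h1 : IsCompactOperator (id : ℝ → ℝ) := by
      rw [isCompactOperator_id_iff_finiteDimensional (𝕜 := ℝ)]; infer_instance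
    exact (h1.comp_clm (innerSL ℝ (A i))).clm_comp
      ((ContinuousLinearMap.id ℝ ℝ).smulRight (e i))
  · intro x y
    change inner ℝ ((∑' i, R i) x) y = inner ℝ x ((∑' i, R i) y)
    have hsum : Summable fun i => y i • A i := by
      refine Summable.of_norm_bounded (hA.mul_left ‖y‖) fun i => ?_
      rw [norm_smul]
      gcongr
      exact lp.norm_apply_le_norm (by norm_num) y i
    -- By symmetry of the kernel, combining the rows with weights `y i` is the same as applying the
    -- operator to `y`.
    have hT : ∑' i, y i • A i = (∑' i, R i) y := by
      ext j
      have h2 : HasSum (fun i => inner ℝ (e j) (y i • A i)) (inner ℝ (e j) (∑' i, y i • A i)) :=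
        hsum.hasSum.mapL (innerSL ℝ (e j))
      rw [hK, hcoord, ← h2.tsum_eq, EllTwo.inner_eq]
      refine tsum_congr fun i => ?_
      rw [← hcoord]
      change y i * A i j = _
      rw [hsymm i j, mul_comm]
    have h3 : HasSum (fun i => inner ℝ x (y i • A i)) (inner ℝ x (∑' i, y i • A i)) :=
      hsum.hasSum.mapL (innerSL ℝ x)
    rw [← hT, ← h3.tsum_eq, EllTwo.inner_eq]
    refine tsum_congr fun i => ?_
    rw [hK, inner_smul_right, real_inner_comm, mul_comm]

/-- An orthonormal family of eigenvectors of a compact operator has only finitely many members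
whose eigenvalues are bounded away from zero. -/
theorem finite_of_orthonormal_eigenvectors {E ι : Type*} [NormedAddCommGroup E]
    [InnerProductSpace ℝ E] (T : E →L[ℝ] E) (hT : IsCompactOperator T) (v : ι → E)
    (hv : Orthonormal ℝ v) (μ : ι → ℝ) (hμ : ∀ i, T (v i) = μ i • v i) (ε : ℝ) (hε : 0 < ε) :
    {i | ε ≤ μ i}.Finite := by
  by_contra hinf
  have hinf : {i | ε ≤ μ i}.Infinite := hinf
  let f := hinf.natEmbedding
  obtain ⟨S, hS, hsub⟩ := hT.image_closedBall_subset_compact (f := (T : E →ₗ[ℝ] E)) 1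
  have hmem : ∀ n, T (v (f n)) ∈ S := fun n => hsub ⟨v (f n), by simp [hv.1], rfl⟩
  obtain ⟨a, -, φ, hφ, hlim⟩ := hS.tendsto_subseq hmem
  have hc := hlim.cauchySeq
  rw [Metric.cauchySeq_iff'] at hc
  obtain ⟨N, hN⟩ := hc ε hε
  have h1 := hN (N + 1) (by omega)
  have hne : ((f (φ (N + 1)) : ι)) ≠ f (φ N) := fun h =>
    absurd (hφ.injective (f.injective (Subtype.ext h))) (by omega)
  simp only [Function.comp] at h1
  rw [dist_eq_norm, hμ, hμ] at h1
  -- By Pythagoras the images of two distinct vectors are at least `ε` apart, so they have no Cauchy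
  -- subsequence.
  have h2 : ‖μ (f (φ (N + 1))) • v (f (φ (N + 1))) - μ (f (φ N)) • v (f (φ N))‖ ^ 2
      = μ (f (φ (N + 1))) ^ 2 + μ (f (φ N)) ^ 2 := by
    rw [norm_sub_sq_real, norm_smul, norm_smul, hv.1, hv.1, inner_smul_left, inner_smul_right,
      hv.2 hne]
    simp
  have h3 : ε ≤ μ (f (φ (N + 1))) := (f (φ (N + 1))).2
  nlinarith [norm_nonneg (μ (f (φ (N + 1))) • v (f (φ (N + 1))) - μ (f (φ N)) • v (f (φ N))),
    sq_nonneg (μ (f (φ N)))]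

section

variable {q : ℝ}

/-! ### The `q`-sine series and its functional equation -/

theorem qShifted_pos (hq0 : 0 < q) (hq1 : q < 1) (n : ℕ) : 0 < qShifted q q n := by
  refine Finset.prod_pos fun k _ => ?_
  have : q ^ k ≤ 1 := pow_le_one₀ hq0.le hq1.le
  nlinarith

theorem qShifted_succ (q : ℝ) (n : ℕ) :
    qShifted q q (n + 1) = qShifted q q n * (1 - q ^ (n + 1)) := by
  rw [qShifted, Finset.prod_range_succ, pow_succ']
  rfl

/-- The coefficient `(-t)^k q^{k(k+1/2)} / (q; q)_{2k+1}`. -/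
noncomputable def sineCoeff (q t : ℝ) (k : ℕ) : ℝ :=
  (-t) ^ k * q ^ ((k : ℝ) * ((k : ℝ) + 1 / 2)) / qShifted q q (2 * k + 1)

/-- The normalised `q`-sine `∑ (-t)^k q^{k(k+1/2)} z^{2k+1} / (q; q)_{2k+1}`, which for `t = λ²`
equals `S_q(λ z) / λ`. -/
noncomputable def sineSeries (q t z : ℝ) : ℝ :=
  ∑' k : ℕ, sineCoeff q t k * z ^ (2 * k + 1)

theorem sineCoeff_succ (hq0 : 0 < q) (hq1 : q < 1) (t : ℝ) (k : ℕ) :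
    sineCoeff q t (k + 1) * ((1 - q ^ (2 * k + 2)) * (1 - q ^ (2 * k + 3))) =
      -(t * √q * q ^ (2 * k + 1)) * sineCoeff q t k := by
  have h1 : q ^ (((k + 1 : ℕ) : ℝ) * (((k + 1 : ℕ) : ℝ) + 1 / 2)) =
      q ^ ((k : ℝ) * ((k : ℝ) + 1 / 2)) * (√q * q ^ (2 * k + 1)) := by
    rw [Real.sqrt_eq_rpow, ← Real.rpow_natCast q (2 * k + 1), ← Real.rpow_add hq0,
      ← Real.rpow_add hq0]
    congr 1
    push_cast
    ring
  have h2 : qShifted q q (2 * (k + 1) + 1) =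
      qShifted q q (2 * k + 1) * ((1 - q ^ (2 * k + 2)) * (1 - q ^ (2 * k + 3))) := by
    rw [show 2 * (k + 1) + 1 = 2 * k + 1 + 1 + 1 by ring, qShifted_succ, qShifted_succ]
    ring
  have h3 := (qShifted_pos hq0 hq1 (2 * k + 1)).ne'
  have h4 : (1 - q ^ (2 * k + 2)) ≠ 0 := by
    have := pow_lt_one₀ hq0.le hq1 (n := 2 * k + 2) (by omega); linarith
  have h5 : (1 - q ^ (2 * k + 3)) ≠ 0 := by
    have := pow_lt_one₀ hq0.le hq1 (n := 2 * k + 3) (by omega); linarith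
  rw [sineCoeff, sineCoeff, h1, h2]
  field_simp
  ring

theorem summable_sineSeries (hq0 : 0 < q) (hq1 : q < 1) (t z : ℝ) :
    Summable fun k => ‖sineCoeff q t k * z ^ (2 * k + 1)‖ := by
  -- Consecutive terms have ratio at most `D * q ^ (2 * k + 1)`, which tends to zero.
  set D : ℝ := |t| * √q * z ^ 2 / (1 - q) ^ 2 with hD
  have hlim : Tendsto (fun k : ℕ => D * q ^ (2 * k + 1)) atTop (𝓝 (D * 0)) := by
    refine Tendsto.const_mul _ ((tendsto_pow_atTop_nhds_zero_of_lt_one hq0.le hq1).comp ?_)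
    exact tendsto_atTop_mono (fun k => show k ≤ 2 * k + 1 by omega) tendsto_id
  rw [mul_zero] at hlim
  have hev : ∀ᶠ k : ℕ in atTop, D * q ^ (2 * k + 1) ≤ 1 / 2 :=
    (hlim.eventually (gt_mem_nhds (by norm_num : (0 : ℝ) < 1 / 2))).mono fun k h => h.le
  refine summable_of_ratio_norm_eventually_le (r := 1 / 2) (by norm_num) ?_
  filter_upwards [hev] with k hk
  have hq2 : q ^ (2 * k + 2) ≤ q := by
    simpa using pow_le_pow_of_le_one hq0.le hq1.le (show 1 ≤ 2 * k + 2 by omega)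
  have hq3 : q ^ (2 * k + 3) ≤ q := by
    simpa using pow_le_pow_of_le_one hq0.le hq1.le (show 1 ≤ 2 * k + 3 by omega)
  have h1q : 0 < 1 - q := by linarith
  have hP : (1 - q) ^ 2 ≤ (1 - q ^ (2 * k + 2)) * (1 - q ^ (2 * k + 3)) := by
    rw [sq]
    exact mul_le_mul (by linarith) (by linarith) h1q.le (by linarith)
  have hrec := congrArg abs (sineCoeff_succ hq0 hq1 t k)
  rw [abs_mul, abs_of_pos (lt_of_lt_of_le (by positivity) hP), abs_mul, abs_neg, abs_mul, abs_mul,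
    abs_of_nonneg (Real.sqrt_nonneg q), abs_of_pos (pow_pos hq0 _)] at hrec
  have hle : |sineCoeff q t (k + 1)| * (1 - q) ^ 2 ≤
      |t| * √q * q ^ (2 * k + 1) * |sineCoeff q t k| := by
    rw [← hrec]; gcongr
  have hle' : |sineCoeff q t (k + 1)| ≤
      |t| * √q * q ^ (2 * k + 1) * |sineCoeff q t k| / (1 - q) ^ 2 := by
    rwa [le_div_iff₀ (by positivity)]
  rw [norm_norm, norm_norm, Real.norm_eq_abs, Real.norm_eq_abs, abs_mul, abs_mul, abs_pow,
    abs_pow, show 2 * (k + 1) + 1 = (2 * k + 1) + 2 by ring, pow_add, sq_abs]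
  calc |sineCoeff q t (k + 1)| * (|z| ^ (2 * k + 1) * z ^ 2)
      ≤ |t| * √q * q ^ (2 * k + 1) * |sineCoeff q t k| / (1 - q) ^ 2 *
          (|z| ^ (2 * k + 1) * z ^ 2) := by gcongr
    _ = (D * q ^ (2 * k + 1)) * (|sineCoeff q t k| * |z| ^ (2 * k + 1)) := by rw [hD]; ring
    _ ≤ 1 / 2 * (|sineCoeff q t k| * |z| ^ (2 * k + 1)) := by gcongr

/-- The left side multiplies `z^m` by `q (1 - q^m) (1 - q^(m-1))`. This kills the linear term, and
on the other odd powers it is the factor in `sineCoeff_succ`. -/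
theorem sineSeries_functional (hq0 : 0 < q) (hq1 : q < 1) (t z : ℝ) :
    q * sineSeries q t z - (1 + q) * sineSeries q t (q * z) + sineSeries q t (q * (q * z)) =
      -(t * √q * z ^ 2 * q) * sineSeries q t (q * z) := by
  have hs : ∀ z, Summable fun k => sineCoeff q t k * z ^ (2 * k + 1) :=
    fun z => (summable_sineSeries hq0 hq1 t z).of_norm
  have h : HasSum (fun k => q * (sineCoeff q t k * z ^ (2 * k + 1)) -
      (1 + q) * (sineCoeff q t k * (q * z) ^ (2 * k + 1)) +
      sineCoeff q t k * (q * (q * z)) ^ (2 * k + 1))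
      (q * sineSeries q t z - (1 + q) * sineSeries q t (q * z) +
        sineSeries q t (q * (q * z))) :=
    (((hs z).hasSum.mul_left q).sub ((hs (q * z)).hasSum.mul_left (1 + q))).add
      (hs (q * (q * z))).hasSum
  rw [← h.tsum_eq, h.summable.tsum_eq_zero_add, sineSeries, ← tsum_mul_left]
  have h0 : q * (sineCoeff q t 0 * z ^ (2 * 0 + 1)) -
      (1 + q) * (sineCoeff q t 0 * (q * z) ^ (2 * 0 + 1)) +
      sineCoeff q t 0 * (q * (q * z)) ^ (2 * 0 + 1) = 0 := by ring
  rw [h0, zero_add]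
  refine tsum_congr fun k => ?_
  have := sineCoeff_succ hq0 hq1 t k
  linear_combination (q * z ^ (2 * k + 3)) * this

theorem abs_sineSeries_le (hq0 : 0 < q) (hq1 : q < 1) (t : ℝ) :
    ∃ C, ∀ z : ℝ, |z| ≤ 1 → |sineSeries q t z| ≤ C * |z| := by
  have hs := summable_sineSeries hq0 hq1 t 1
  simp only [one_pow, mul_one] at hs
  refine ⟨∑' k, ‖sineCoeff q t k‖, fun z hz => ?_⟩
  rw [← tsum_mul_right, ← Real.norm_eq_abs]
  refine tsum_of_norm_bounded (hs.mul_right |z|).hasSum fun k => ?_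
  rw [norm_mul, norm_pow, Real.norm_eq_abs z, pow_succ]
  gcongr
  exact mul_le_of_le_one_left (abs_nonneg _) (pow_le_one₀ (abs_nonneg _) hz)

theorem abs_sineSeries_sub_le (hq0 : 0 < q) (hq1 : q < 1) (t : ℝ) :
    ∃ C, ∀ z : ℝ, |z| ≤ 1 → |sineSeries q t z - sineCoeff q t 0 * z| ≤ C * |z| ^ 3 := by
  have hs := summable_sineSeries hq0 hq1 t 1
  simp only [one_pow, mul_one] at hs
  refine ⟨∑' k, ‖sineCoeff q t (k + 1)‖, fun z hz => ?_⟩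
  rw [sineSeries, (summable_sineSeries hq0 hq1 t z).of_norm.tsum_eq_zero_add]
  simp only [mul_zero, zero_add, pow_one, add_sub_cancel_left]
  rw [← tsum_mul_right, ← Real.norm_eq_abs]
  refine tsum_of_norm_bounded (((summable_nat_add_iff 1).2 hs).mul_right (|z| ^ 3)).hasSum
    fun k => ?_
  rw [norm_mul, norm_pow, Real.norm_eq_abs z,
    show 2 * (k + 1) + 1 = 2 * k + 3 by ring, pow_add]
  gcongr
  exact mul_le_of_le_one_left (by positivity) (pow_le_one₀ (abs_nonneg _) hz)

theorem sineCoeff_zero_pos (hq0 : 0 < q) (hq1 : q < 1) (t : ℝ) : 0 < sineCoeff q t 0 := by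
  have := qShifted_pos hq0 hq1 (2 * 0 + 1)
  rw [sineCoeff]
  simp only [pow_zero, Nat.cast_zero, zero_mul, Real.rpow_zero, one_mul]
  positivity

theorem sineSeries_one_pos_of_nonpos (hq0 : 0 < q) (hq1 : q < 1) {t : ℝ} (ht : t ≤ 0) :
    0 < sineSeries q t 1 := by
  refine (summable_sineSeries hq0 hq1 t 1).of_norm.tsum_pos (fun k => ?_) 0 ?_
  · have := qShifted_pos hq0 hq1 (2 * k + 1)
    have h2 : 0 ≤ -t := by linarith
    rw [sineCoeff]
    positivity
  · simpa using sineCoeff_zero_pos hq0 hq1 t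

/-- As `z = q^n` tends to zero, the linear term, with positive coefficient, dominates the cubic
remainder. Hence the sine is a nontrivial solution on the grid. -/
theorem exists_sineSeries_pow_ne_zero (hq0 : 0 < q) (hq1 : q < 1) (t : ℝ) :
    ∃ n : ℕ, sineSeries q t (q ^ n) ≠ 0 := by
  by_contra! h
  obtain ⟨C, hC⟩ := abs_sineSeries_sub_le hq0 hq1 t
  have hc := sineCoeff_zero_pos hq0 hq1 t
  have hle : ∀ n : ℕ, sineCoeff q t 0 ≤ C * (q ^ n) ^ 2 := fun n => by
    have hp : 0 < q ^ n := pow_pos hq0 n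
    have h1 := hC (q ^ n) (by rw [abs_of_pos hp]; exact pow_le_one₀ hq0.le hq1.le)
    rw [h n, zero_sub, abs_neg, abs_of_pos hp, abs_of_pos (mul_pos hc hp)] at h1
    refine le_of_mul_le_mul_right ?_ hp
    linarith [h1, show C * (q ^ n) ^ 2 * q ^ n = C * (q ^ n) ^ 3 by ring]
  have hlim : Tendsto (fun n : ℕ => C * (q ^ n) ^ 2) atTop (𝓝 (C * 0 ^ 2)) :=
    ((tendsto_pow_atTop_nhds_zero_of_lt_one hq0.le hq1).pow 2).const_mul C
  have := ge_of_tendsto' hlim hle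
  norm_num at this
  linarith

theorem qSin_mul_eq (q s z : ℝ) : qSin q (s * z) = s * sineSeries q (s ^ 2) z := by
  rw [qSin, sineSeries, ← tsum_mul_left]
  refine tsum_congr fun k => ?_
  rw [sineCoeff, neg_pow (s ^ 2), mul_pow, ← pow_mul, pow_succ s (2 * k)]
  ring

theorem qSin_neg (q z : ℝ) : qSin q (-z) = -qSin q z := by
  rw [qSin, qSin, ← tsum_neg]
  refine tsum_congr fun k => ?_
  rw [Odd.neg_pow ⟨k, rfl⟩]
  ring

/-! ### Decaying solutions of the `q`-difference equation -/

/-- Sequences `u n = f (q^n)` of size `O(q^n)` that solve the second-order `q`-difference equation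
`u (n + 2) = (1 + q - τ q^{2n+2}) u (n + 1) - q u n`. -/
structure IsDecayingSolution (q τ : ℝ) (u : ℕ → ℝ) : Prop where
  bound : ∃ C, ∀ n, |u n| ≤ C * q ^ n
  recurrence : ∀ n, u (n + 2) = (1 + q - τ * q ^ (2 * n + 2)) * u (n + 1) - q * u n

/-- The recurrence multiplies the Casoratian by exactly `q` at each step, whereas the decay of both
solutions makes it `O(q^(2n))`. -/
theorem IsDecayingSolution.casoratian_eq_zero (hq0 : 0 < q) (hq1 : q < 1) {τ : ℝ} {u f : ℕ → ℝ}
    (hu : IsDecayingSolution q τ u) (hf : IsDecayingSolution q τ f) (n : ℕ) :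
    u n * f (n + 1) = u (n + 1) * f n := by
  have hW : ∀ n, u n * f (n + 1) - u (n + 1) * f n = q ^ n * (u 0 * f 1 - u 1 * f 0) := by
    intro n
    induction n with
    | zero => simp
    | succ n ih =>
      rw [hu.recurrence, hf.recurrence, pow_succ]
      linear_combination q * ih
  obtain ⟨C, hC⟩ := hu.bound
  obtain ⟨B, hB⟩ := hf.bound
  have hC0 : 0 ≤ C := by simpa using (abs_nonneg _).trans (hC 0)
  have hB0 : 0 ≤ B := by simpa using (abs_nonneg _).trans (hB 0)
  have hle : ∀ n, |u 0 * f 1 - u 1 * f 0| ≤ 2 * C * B * q * q ^ n := fun n => by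
    have hp : 0 < q ^ n := pow_pos hq0 n
    refine le_of_mul_le_mul_left ?_ hp
    calc q ^ n * |u 0 * f 1 - u 1 * f 0| = |u n * f (n + 1) - u (n + 1) * f n| := by
          rw [hW n, abs_mul, abs_of_pos hp]
      _ ≤ |u n| * |f (n + 1)| + |u (n + 1)| * |f n| := by
          rw [← abs_mul, ← abs_mul]; exact abs_sub _ _
      _ ≤ (C * q ^ n) * (B * q ^ (n + 1)) + (C * q ^ (n + 1)) * (B * q ^ n) := by
          gcongr
          all_goals first | exact hC _ | exact hB _
      _ = q ^ n * (2 * C * B * q * q ^ n) := by ring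
  have hlim : Tendsto (fun n : ℕ => 2 * C * B * q * q ^ n) atTop (𝓝 (2 * C * B * q * 0)) :=
    (tendsto_pow_atTop_nhds_zero_of_lt_one hq0.le hq1).const_mul _
  have h0 := ge_of_tendsto' hlim hle
  rw [mul_zero] at h0
  have h1 : u 0 * f 1 - u 1 * f 0 = 0 := abs_nonpos_iff.1 h0
  have := hW n
  rw [h1, mul_zero] at this
  linarith

theorem IsDecayingSolution.eq_zero {τ : ℝ} {u : ℕ → ℝ} (hu : IsDecayingSolution q τ u)
    (h0 : u 0 = 0) (h1 : u 1 = 0) (n : ℕ) : u n = 0 := by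
  suffices h : u n = 0 ∧ u (n + 1) = 0 from h.1
  induction n with
  | zero => exact ⟨h0, h1⟩
  | succ n ih => exact ⟨ih.2, by rw [hu.recurrence, ih.1, ih.2]; ring⟩

/-- The decaying solution is unique up to scaling. -/
theorem IsDecayingSolution.eq_const_mul (hq0 : 0 < q) (hq1 : q < 1) {τ : ℝ} {u f : ℕ → ℝ}
    (hu : IsDecayingSolution q τ u) (hf : IsDecayingSolution q τ f) (hu0 : u 0 = 0)
    (hune : ∃ n, u n ≠ 0) (hfne : ∃ n, f n ≠ 0) : f 0 = 0 ∧ ∃ c, ∀ n, u n = c * f n := by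
  have hu1 : u 1 ≠ 0 := fun h => hune.elim fun n hn => hn (hu.eq_zero hu0 h n)
  have hf0 : f 0 = 0 := by
    have := hu.casoratian_eq_zero hq0 hq1 hf 0
    rw [hu0, zero_mul] at this
    exact (mul_eq_zero.1 this.symm).resolve_left hu1
  have hf1 : f 1 ≠ 0 := fun h => hfne.elim fun n hn => hn (hf.eq_zero hf0 h n)
  refine ⟨hf0, u 1 / f 1, fun n => ?_⟩
  suffices h : u n = u 1 / f 1 * f n ∧ u (n + 1) = u 1 / f 1 * f (n + 1) from h.1
  induction n with
  | zero => exact ⟨by rw [hu0, hf0, mul_zero], by field_simp⟩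
  | succ n ih => exact ⟨ih.2, by rw [hu.recurrence, hf.recurrence, ih.1, ih.2]; ring⟩

theorem isDecayingSolution_sineSeries (hq0 : 0 < q) (hq1 : q < 1) (τ : ℝ) :
    IsDecayingSolution q τ fun n => sineSeries q (τ * √q) (q ^ n) := by
  refine ⟨?_, fun n => ?_⟩
  · obtain ⟨C, hC⟩ := abs_sineSeries_le hq0 hq1 (τ * √q)
    refine ⟨C, fun n => ?_⟩
    have hp : 0 < q ^ n := pow_pos hq0 n
    simpa [abs_of_pos hp] using
      hC (q ^ n) (by rw [abs_of_pos hp]; exact pow_le_one₀ hq0.le hq1.le)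
  · have h := sineSeries_functional hq0 hq1 (τ * √q) (q ^ n)
    rw [← pow_succ' q n, ← pow_succ' q (n + 1)] at h
    have hs : √q * √q = q := Real.mul_self_sqrt hq0.le
    linear_combination h - τ * q * (q ^ n) ^ 2 * sineSeries q (τ * √q) (q ^ (n + 1)) * hs

/-! ### The Green operator -/

/-- The Green kernel of the second `q`-difference operator with zero boundary values. -/
noncomputable def greenKernel (q : ℝ) (n j : ℕ) : ℝ :=
  (q ^ max n j - q ^ (n + j)) / (1 - q)

/-- The sequence `u n = ∑ j, G(n, j + 1) y j`. -/
noncomputable def greenSum (q : ℝ) (y : ℕ → ℝ) (n : ℕ) : ℝ :=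
  ∑' j, greenKernel q n (j + 1) * y j

theorem abs_greenKernel_le (hq0 : 0 < q) (hq1 : q < 1) (n j : ℕ) :
    |greenKernel q n j| ≤ 1 / (1 - q) * q ^ n := by
  have h1 : q ^ (n + j) ≤ q ^ max n j := pow_le_pow_of_le_one hq0.le hq1.le (by omega)
  have h2 : q ^ max n j ≤ q ^ n := pow_le_pow_of_le_one hq0.le hq1.le (by omega)
  have h3 : 0 < q ^ (n + j) := by positivity
  have h4 : 0 < 1 - q := by linarith
  rw [greenKernel, abs_div, abs_of_pos h4, abs_of_nonneg (by linarith), div_mul_eq_mul_div, one_mul]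
  gcongr
  linarith

/-- Both branches of the kernel are combinations of `1` and `q^n`, the homogeneous solutions. Only
the change of branch leaves a point source. -/
theorem greenKernel_rec (hq1 : q < 1) (n j : ℕ) :
    greenKernel q (n + 2) (j + 1) = (1 + q) * greenKernel q (n + 1) (j + 1) -
      q * greenKernel q n (j + 1) - if j = n then q ^ (n + 1) else 0 := by
  have h4 : 1 - q ≠ 0 := by linarith
  simp only [greenKernel]
  rcases lt_trichotomy j n with h | h | h
  · rw [if_neg h.ne, max_eq_left (by omega), max_eq_left (by omega), max_eq_left (by omega)]
    field_simp
    ring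
  · subst h
    rw [if_pos rfl, max_eq_left (by omega), max_eq_left (by omega), max_eq_right (by omega)]
    field_simp
    ring
  · rw [if_neg h.ne', max_eq_right (by omega), max_eq_right (by omega), max_eq_right (by omega)]
    field_simp
    ring

theorem summable_greenKernel_mul (hq0 : 0 < q) (hq1 : q < 1) {y : ℕ → ℝ}
    (hy : Summable fun j => |y j|) (n : ℕ) :
    Summable fun j => greenKernel q n (j + 1) * y j := by
  refine Summable.of_norm_bounded (hy.mul_left (1 / (1 - q) * q ^ n)) fun j => ?_
  rw [norm_mul, Real.norm_eq_abs, Real.norm_eq_abs]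
  gcongr
  exact abs_greenKernel_le hq0 hq1 _ _

theorem greenSum_zero (q : ℝ) (y : ℕ → ℝ) : greenSum q y 0 = 0 := by
  simp [greenSum, greenKernel]

theorem abs_greenSum_le (hq0 : 0 < q) (hq1 : q < 1) {y : ℕ → ℝ} (hy : Summable fun j => |y j|)
    (n : ℕ) : |greenSum q y n| ≤ (1 / (1 - q) * ∑' j, |y j|) * q ^ n := by
  rw [← Real.norm_eq_abs, mul_right_comm, ← tsum_mul_left]
  refine tsum_of_norm_bounded (hy.mul_left (1 / (1 - q) * q ^ n)).hasSum fun j => ?_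
  rw [norm_mul, Real.norm_eq_abs, Real.norm_eq_abs]
  gcongr
  exact abs_greenKernel_le hq0 hq1 _ _

theorem greenSum_rec (hq0 : 0 < q) (hq1 : q < 1) {y : ℕ → ℝ} (hy : Summable fun j => |y j|)
    (n : ℕ) : greenSum q y (n + 2) =
      (1 + q) * greenSum q y (n + 1) - q * greenSum q y n - q ^ (n + 1) * y n := by
  have hs := fun n => (summable_greenKernel_mul hq0 hq1 hy n).hasSum
  have h := (((hs (n + 1)).mul_left (1 + q)).sub ((hs n).mul_left q)).sub
    (hasSum_ite_eq n (q ^ (n + 1) * y n))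
  refine Eq.trans (tsum_congr fun j => ?_) h.tsum_eq
  rw [greenKernel_rec hq1]
  split_ifs with hj
  · subst hj; ring
  · ring

/-- The difference of the two sides is a decaying homogeneous solution vanishing at `0`. If nonzero,
it would force `q^n` to vanish at `n = 0` as well. -/
theorem eq_greenSum (hq0 : 0 < q) (hq1 : q < 1) {u y : ℕ → ℝ} (hy : Summable fun j => |y j|)
    (hu0 : u 0 = 0) (hub : ∃ C, ∀ n, |u n| ≤ C * q ^ n)
    (hrec : ∀ n, u (n + 2) = (1 + q) * u (n + 1) - q * u n - q ^ (n + 1) * y n) (n : ℕ) :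
    u n = greenSum q y n := by
  have hv : IsDecayingSolution q 0 fun n => u n - greenSum q y n := by
    refine ⟨?_, fun n => ?_⟩
    · obtain ⟨C, hC⟩ := hub
      refine ⟨C + 1 / (1 - q) * ∑' j, |y j|, fun n => (abs_sub _ _).trans ?_⟩
      rw [add_mul]
      exact add_le_add (hC n) (abs_greenSum_le hq0 hq1 hy n)
    · rw [hrec, greenSum_rec hq0 hq1 hy]; ring
  have hf : IsDecayingSolution q 0 fun n => q ^ n :=
    ⟨⟨1, fun n => by simp [abs_of_pos hq0]⟩, fun n => by ring⟩
  by_contra hne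
  have := (hv.eq_const_mul hq0 hq1 hf (by simp [hu0, greenSum_zero])
    ⟨n, sub_ne_zero.2 hne⟩ ⟨0, by simp⟩).1
  simp at this

theorem summable_sqrt_pow_mul (hq0 : 0 < q) (hq1 : q < 1) (x : EllTwo) :
    Summable fun j => |√q ^ (j + 1) * x j| := by
  have hr : √q < 1 := by rw [Real.sqrt_lt' one_pos]; simpa using hq1
  obtain ⟨y, hy, -⟩ := EllTwo.exists_of_geometric_bound (Real.sqrt_nonneg q) hr
    (Real.sqrt_nonneg q) (x := fun n => √q ^ (n + 1))
    (fun n => by rw [abs_of_nonneg (by positivity), pow_succ'])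
  simpa [hy] using (EllTwo.summable_mul y x).abs

/-- The inverse of the second `q`-difference operator is compact and symmetric on `ℓ²`. -/
theorem exists_green_operator (hq0 : 0 < q) (hq1 : q < 1) :
    ∃ K : EllTwo →L[ℝ] EllTwo,
      (∀ x i, K x i = √q ^ (i + 1) * greenSum q (fun j => √q ^ (j + 1) * x j) (i + 1)) ∧
      IsCompactOperator K ∧ (K : EllTwo →ₗ[ℝ] EllTwo).IsSymmetric := by
  have hr : √q < 1 := by rw [Real.sqrt_lt' one_pos]; simpa using hq1
  have hr0 : 0 ≤ √q := Real.sqrt_nonneg q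
  have hq1' : 0 < 1 - q := by linarith
  have hb : ∀ i j, |√q ^ (i + 1) * √q ^ (j + 1) * greenKernel q (i + 1) (j + 1)| ≤
      1 / (1 - q) * √q ^ i * √q ^ j := fun i j => by
    rw [abs_mul, abs_of_nonneg (by positivity)]
    calc √q ^ (i + 1) * √q ^ (j + 1) * |greenKernel q (i + 1) (j + 1)|
        ≤ √q ^ i * √q ^ j * (1 / (1 - q) * 1) := by
          gcongr ?_ * ?_ * ?_
          · exact pow_le_pow_of_le_one hr0 hr.le (by omega)
          · exact pow_le_pow_of_le_one hr0 hr.le (by omega)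
          · refine (abs_greenKernel_le hq0 hq1 _ _).trans ?_
            gcongr
            exact pow_le_one₀ hq0.le hq1.le
      _ = _ := by ring
  choose A hA hAn using fun i =>
    EllTwo.exists_of_geometric_bound hr0 hr (C := 1 / (1 - q) * √q ^ i) (by positivity) (hb i)
  have hsum : Summable fun i => ‖A i‖ := by
    refine Summable.of_nonneg_of_le (fun i => norm_nonneg _) hAn ?_
    exact ((summable_geometric_of_lt_one hr0 hr).mul_left _).div_const _
  obtain ⟨K, hK, hKc, hKs⟩ := EllTwo.exists_compact_operator A hsum fun i j => by
    rw [hA, hA, greenKernel, greenKernel, max_comm, add_comm (i + 1)]; ring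
  refine ⟨K, fun x i => ?_, hKc, hKs⟩
  rw [hK, EllTwo.inner_eq, greenSum, ← tsum_mul_left]
  refine tsum_congr fun j => ?_
  rw [hA]
  ring

/-! ### Zeros of `S_q` and the orthogonal basis of sine vectors -/

/-- Such a set is a locally finite linear order with a least and no greatest element, hence order
isomorphic to `ℕ`. -/
theorem exists_strictMono_range_eq {Z : Set ℝ} (hinf : Z.Infinite)
    (hfin : ∀ M, {z ∈ Z | z ≤ M}.Finite) :
    ∃ w : ℕ → ℝ, StrictMono w ∧ Set.range w = Z := by
  classical
  have hIcc : ∀ a b : Z, (Set.Icc a b).Finite := fun a b => by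
    refine Set.Finite.of_finite_image ((hfin b).subset ?_) Subtype.val_injective.injOn
    rintro _ ⟨x, hx, rfl⟩
    exact ⟨x.2, hx.2⟩
  let : LocallyFiniteOrder Z := LocallyFiniteOrder.ofFiniteIcc hIcc
  obtain ⟨z₀, hz₀⟩ := hinf.nonempty
  obtain ⟨m, hm, hmin⟩ := Set.exists_min_image _ id (hfin z₀) ⟨z₀, hz₀, le_rfl⟩
  let : OrderBot Z :=
    { bot := ⟨m, hm.1⟩
      bot_le := fun z => by
        rcases le_total (z : ℝ) z₀ with h | h
        · exact hmin z ⟨z.2, h⟩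
        · exact hm.2.trans h }
  have : NoMaxOrder Z := ⟨fun z => by
    by_contra! h
    exact hinf ((hfin z).subset fun x hx => ⟨hx, h ⟨x, hx⟩⟩)⟩
  let : SuccOrder Z := LinearLocallyFiniteOrder.succOrder (ι := Z)
  let : PredOrder Z := LinearLocallyFiniteOrder.predOrder (ι := Z)
  let e : Z ≃o ℕ := orderIsoNatOfLinearSuccPredArch
  refine ⟨fun n => e.symm n, fun a b h => e.symm.strictMono h, ?_⟩
  ext z
  constructor
  · rintro ⟨n, rfl⟩
    exact (e.symm n).2
  · intro hz
    exact ⟨e ⟨z, hz⟩, by simp⟩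

theorem isDecayingSolution_qSin (hq0 : 0 < q) (hq1 : q < 1) (z : ℝ) :
    IsDecayingSolution q (z ^ 2 / √q) fun n => qSin q (z * q ^ n) := by
  have hs : √q ≠ 0 := (Real.sqrt_pos.2 hq0).ne'
  have h := isDecayingSolution_sineSeries hq0 hq1 (z ^ 2 / √q)
  rw [div_mul_cancel₀ _ hs] at h
  simp only [qSin_mul_eq]
  obtain ⟨C, hC⟩ := h.bound
  refine ⟨⟨|z| * C, fun n => ?_⟩, fun n => ?_⟩
  · rw [abs_mul, mul_assoc]
    gcongr
    exact hC n
  · rw [h.recurrence]; ring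

/-- The vectors `(q^{(i+1)/2} S_q(z q^{i+1}))_i` of `ℓ²`. -/
theorem exists_sineVector (hq0 : 0 < q) (hq1 : q < 1) (z : ℝ) :
    ∃ Φ : EllTwo, ∀ i, Φ i = √q ^ (i + 1) * qSin q (z * q ^ (i + 1)) := by
  have hr : √q < 1 := by rw [Real.sqrt_lt' one_pos]; simpa using hq1
  obtain ⟨C, hC⟩ := (isDecayingSolution_qSin hq0 hq1 z).bound
  have hC0 : 0 ≤ C := by simpa using (abs_nonneg _).trans (hC 0)
  obtain ⟨Φ, hΦ, -⟩ := EllTwo.exists_of_geometric_bound (Real.sqrt_nonneg q) hr hC0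
    (x := fun i => √q ^ (i + 1) * qSin q (z * q ^ (i + 1))) fun i => by
      rw [abs_mul, abs_of_nonneg (by positivity)]
      calc √q ^ (i + 1) * |qSin q (z * q ^ (i + 1))| ≤ √q ^ i * (C * 1) := by
            gcongr ?_ * ?_
            · exact pow_le_pow_of_le_one (Real.sqrt_nonneg q) hr.le (by omega)
            · refine (hC _).trans ?_
              gcongr
              exact pow_le_one₀ hq0.le hq1.le
        _ = C * √q ^ i := by ring
  exact ⟨Φ, hΦ⟩

theorem sineVector_ne_zero (hq0 : 0 < q) (hq1 : q < 1) {z : ℝ} (hz : 0 < z) (hz0 : qSin q z = 0)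
    {Φ : EllTwo} (hΦ : ∀ i, Φ i = √q ^ (i + 1) * qSin q (z * q ^ (i + 1))) : Φ ≠ 0 := by
  rintro rfl
  obtain ⟨n, hn⟩ := exists_sineSeries_pow_ne_zero hq0 hq1 (z ^ 2)
  refine hn ((mul_eq_zero.1 ((qSin_mul_eq q z (q ^ n)).symm.trans ?_)).resolve_left hz.ne')
  rcases n with _ | n
  · simpa using hz0
  · have := hΦ n
    rw [lp.coeFn_zero, Pi.zero_apply, eq_comm] at this
    exact (mul_eq_zero.1 this).resolve_left (pow_pos (Real.sqrt_pos.2 hq0) _).ne'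

theorem sqrt_pow_mul_self (hq0 : 0 < q) (n : ℕ) : √q ^ n * √q ^ n = q ^ n := by
  rw [← mul_pow, Real.mul_self_sqrt hq0.le]

/-- The sine sequence vanishes at `n = 0` because `z` is a zero, so it is the Green sum of its own
source term. -/
theorem green_apply_sineVector (hq0 : 0 < q) (hq1 : q < 1) {K : EllTwo →L[ℝ] EllTwo}
    (hK : ∀ x i, K x i = √q ^ (i + 1) * greenSum q (fun j => √q ^ (j + 1) * x j) (i + 1))
    {z : ℝ} (hz : 0 < z) (hz0 : qSin q z = 0)
    {Φ : EllTwo} (hΦ : ∀ i, Φ i = √q ^ (i + 1) * qSin q (z * q ^ (i + 1))) :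
    K Φ = (√q / z ^ 2) • Φ := by
  have hs : √q ≠ 0 := (Real.sqrt_pos.2 hq0).ne'
  have hsol := isDecayingSolution_qSin hq0 hq1 z
  ext i
  have h := eq_greenSum hq0 hq1 (u := fun n => qSin q (z * q ^ n))
    (y := fun j => z ^ 2 / √q * (√q ^ (j + 1) * Φ j))
    (by simpa [abs_mul] using (summable_sqrt_pow_mul hq0 hq1 Φ).mul_left |z ^ 2 / √q|)
    (by simpa using hz0) hsol.bound
    (fun n => by
      rw [hsol.recurrence, hΦ]
      linear_combination (z ^ 2 / √q * q ^ (n + 1) * qSin q (z * q ^ (n + 1))) *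
        sqrt_pow_mul_self hq0 (n + 1)) (i + 1)
  have h2 : greenSum q (fun j => z ^ 2 / √q * (√q ^ (j + 1) * Φ j)) (i + 1) =
      z ^ 2 / √q * greenSum q (fun j => √q ^ (j + 1) * Φ j) (i + 1) := by
    rw [greenSum, greenSum, ← tsum_mul_left]
    exact tsum_congr fun j => by ring
  rw [h2] at h
  change K Φ i = √q / z ^ 2 * Φ i
  rw [hK, hΦ i]
  change qSin q (z * q ^ (i + 1)) = _ at h
  rw [h]
  field_simp

/-- Every eigenvector of the Green operator is a multiple of some sine vector. -/
theorem green_eigenvector (hq0 : 0 < q) (hq1 : q < 1) {K : EllTwo →L[ℝ] EllTwo}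
    (hK : ∀ x i, K x i = √q ^ (i + 1) * greenSum q (fun j => √q ^ (j + 1) * x j) (i + 1))
    {x : EllTwo} (hx : x ≠ 0) {μ : ℝ} (hμ : K x = μ • x) :
    ∃ z, 0 < z ∧ qSin q z = 0 ∧
      ∃ c : ℝ, ∀ i, x i = c * (√q ^ (i + 1) * qSin q (z * q ^ (i + 1))) := by
  have hs0 : 0 < √q := Real.sqrt_pos.2 hq0
  have hsum := summable_sqrt_pow_mul hq0 hq1 x
  set u : ℕ → ℝ := greenSum q (fun j => √q ^ (j + 1) * x j) with hu
  have hu0 : u 0 = 0 := greenSum_zero _ _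
  have hrec : ∀ n, u (n + 2) = (1 + q) * u (n + 1) - q * u n -
      q ^ (n + 1) * (√q ^ (n + 1) * x n) := greenSum_rec hq0 hq1 hsum
  have hux : ∀ i, √q ^ (i + 1) * u (i + 1) = μ * x i := fun i => by
    rw [← hK, hμ]; rfl
  -- The source can be read off from `u` through the recurrence, so the operator is injective and `μ
  -- ≠ 0`.
  have hune : ∃ n, u n ≠ 0 := by
    by_contra! h
    refine hx ?_
    ext n
    have h2 := hrec n
    rw [h, h, h] at h2
    have h3 : q ^ (n + 1) * √q ^ (n + 1) * x n = 0 := by linarith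
    exact (mul_eq_zero.1 h3).resolve_left (by positivity)
  have hμ0 : μ ≠ 0 := by
    rintro rfl
    obtain ⟨n, hn⟩ := hune
    rcases n with _ | n
    · exact hn hu0
    · have := hux n
      rw [zero_mul] at this
      exact hn ((mul_eq_zero.1 this).resolve_left (by positivity))
  have hx' : ∀ n, x n = √q ^ (n + 1) * u (n + 1) / μ := fun n => by
    rw [hux]; field_simp
  have hsol : IsDecayingSolution q (1 / μ) u := by
    refine ⟨⟨_, abs_greenSum_le hq0 hq1 hsum⟩, fun n => ?_⟩
    rw [hrec, hx']
    linear_combination (-(q ^ (n + 1) * u (n + 1) / μ)) * sqrt_pow_mul_self hq0 (n + 1)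
  obtain ⟨h0, c, hc⟩ := hsol.eq_const_mul hq0 hq1
    (isDecayingSolution_sineSeries hq0 hq1 (1 / μ)) hu0 hune
    (exists_sineSeries_pow_ne_zero hq0 hq1 _)
  rw [pow_zero] at h0
  -- For a nonpositive parameter all terms of the series at `1` are nonnegative and the first is
  -- positive, contradicting the boundary zero.
  have ht : 0 < 1 / μ * √q := by
    by_contra! ht
    exact (sineSeries_one_pos_of_nonpos hq0 hq1 ht).ne' h0
  have hz := Real.sqrt_pos.2 ht
  have hsq : √(1 / μ * √q) ^ 2 = 1 / μ * √q := Real.sq_sqrt ht.le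
  set z := √(1 / μ * √q)
  refine ⟨z, hz, ?_, c / (μ * z), fun i => ?_⟩
  · have := qSin_mul_eq q z 1
    rwa [mul_one, hsq, h0, mul_zero] at this
  · rw [hx', qSin_mul_eq, hsq, hc]
    field_simp

theorem EllTwo.not_finiteDimensional : ¬ FiniteDimensional ℝ EllTwo := by
  intro h
  have ho : Orthonormal ℝ fun i : ℕ => (lp.single 2 i (1 : ℝ) : EllTwo) := by
    rw [orthonormal_iff_ite]
    intro i j
    rw [lp.inner_single_left]
    simp [lp.single_apply, Pi.single_apply]
  exact Infinite.not_finite ho.linearIndependent.finite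

/-- The sine vectors at the positive zeros of `S_q`, listed increasingly, form an orthogonal basis
of `ℓ²`. -/
theorem exists_sine_basis (hq0 : 0 < q) (hq1 : q < 1) :
    ∃ w : ℕ → ℝ, StrictMono w ∧ Set.range w = {z : ℝ | 0 < z ∧ qSin q z = 0} ∧
      ∀ y : ℕ → ℝ, (Summable fun i => y i ^ 2) → ∃ b B : ℕ → ℝ, Tendsto B atTop (𝓝 0) ∧
        ∀ N, HasSum (fun i => (∑ r ∈ Finset.range N,
          b r * (√q ^ (i + 1) * qSin q (w r * q ^ (i + 1))) - y i) ^ 2) (B N) := by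
  obtain ⟨K, hK, hKc, hKs⟩ := exists_green_operator hq0 hq1
  choose Φ hΦ using exists_sineVector hq0 hq1
  have hs0 : 0 < √q := Real.sqrt_pos.2 hq0
  set Z : Set ℝ := {z : ℝ | 0 < z ∧ qSin q z = 0} with hZ
  have hne : ∀ z : Z, Φ z ≠ 0 := fun z => sineVector_ne_zero hq0 hq1 z.2.1 z.2.2 (hΦ z)
  have hev : ∀ z : Z, K (Φ z) = (√q / (z : ℝ) ^ 2) • Φ z := fun z =>
    green_apply_sineVector hq0 hq1 hK z.2.1 z.2.2 (hΦ z)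
  -- Every eigenspace, for whatever `μ`, consists of multiples of sine vectors, and the eigenspaces
  -- of a compact symmetric operator have trivial common orthogonal complement.
  have hcomplete : ∀ y : EllTwo, (∀ z : Z, inner ℝ (Φ z) y = 0) → y = 0 := by
    intro y hy
    have hbot := ContinuousLinearMap.orthogonalComplement_iSup_eigenspaces_eq_bot hKc hKs
    rw [← Submodule.mem_bot ℝ, ← hbot, ← Submodule.iInf_orthogonal, Submodule.mem_iInf]
    intro μ
    rw [Submodule.mem_orthogonal]
    intro x hx
    by_cases hx0 : x = 0
    · rw [hx0, inner_zero_left]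
    · obtain ⟨z, hz, hz0, c, hc⟩ := green_eigenvector hq0 hq1 hK hx0
        (Module.End.mem_eigenspace_iff.1 hx)
      have : x = c • Φ z := by
        ext i
        change x i = c * Φ z i
        rw [hc, hΦ]
      rw [this, inner_smul_left, hy ⟨z, hz, hz0⟩, mul_zero]
  let v : Z → EllTwo := fun z => ‖Φ z‖⁻¹ • Φ z
  have hvev : ∀ z : Z, K (v z) = (√q / (z : ℝ) ^ 2) • v z := fun z => by
    simp only [v, map_smul, hev]
    rw [smul_comm]
  have hv : Orthonormal ℝ v := by
    refine ⟨fun z => ?_, fun z z' hzz => ?_⟩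
    · rw [norm_smul, norm_inv, norm_norm, inv_mul_cancel₀ (norm_ne_zero_iff.2 (hne z))]
    · have h1 : inner ℝ (K (v z)) (v z') = inner ℝ (v z) (K (v z')) := hKs _ _
      rw [hvev, hvev, real_inner_smul_left (v z), real_inner_smul_right _ (v z'), ← sub_eq_zero, ← sub_mul] at h1
      refine (mul_eq_zero.1 h1).resolve_left fun h2 => hzz (Subtype.ext ?_)
      have hz := z.2.1
      have hz' := z'.2.1
      rw [sub_eq_zero, div_eq_div_iff (by positivity) (by positivity)] at h2
      have h3 := mul_left_cancel₀ hs0.ne' h2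
      exact ((pow_left_inj₀ hz'.le hz.le two_ne_zero).1 h3).symm
  have hvc : ∀ y : EllTwo, (∀ z : Z, inner ℝ (v z) y = 0) → y = 0 := fun y hy => by
    refine hcomplete y fun z => ?_
    have := hy z
    rw [inner_smul_left] at this
    refine (mul_eq_zero.1 this).resolve_left ?_
    simpa using hne z
  have hinf : Z.Infinite := by
    intro hfin
    have : Finite Z := hfin
    have hfd : FiniteDimensional ℝ (Submodule.span ℝ (Set.range v)) :=
      FiniteDimensional.span_of_finite ℝ (Set.finite_range v)
    have htop : Submodule.span ℝ (Set.range v) = ⊤ := by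
      rw [← Submodule.orthogonal_eq_bot_iff, Submodule.eq_bot_iff]
      intro y hy
      exact hvc y fun z => hy _ (Submodule.subset_span ⟨z, rfl⟩)
    rw [htop] at hfd
    exact EllTwo.not_finiteDimensional
      (LinearEquiv.finiteDimensional (Submodule.topEquiv (R := ℝ) (M := EllTwo)))
  -- A zero `z ≤ M` has eigenvalue at least `√q / (M² + 1)`; the `+ 1` keeps this bound meaningful
  -- at `M = 0`.
  have hfinM : ∀ M, {z ∈ Z | z ≤ M}.Finite := fun M => by
    have := (finite_of_orthonormal_eigenvectors K hKc v hv _ hvev (√q / (M ^ 2 + 1))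
      (by positivity)).image Subtype.val
    refine this.subset ?_
    rintro z ⟨hz, hzM⟩
    refine ⟨⟨z, hz⟩, ?_, rfl⟩
    have hz0 : 0 < z := hz.1
    change √q / (M ^ 2 + 1) ≤ √q / z ^ 2
    gcongr
    nlinarith
  obtain ⟨w, hw, hwZ⟩ := exists_strictMono_range_eq hinf hfinM
  refine ⟨w, hw, hwZ, fun y hy => ?_⟩
  have hwm : ∀ n, w n ∈ Z := fun n => hwZ ▸ ⟨n, rfl⟩
  let e : ℕ → EllTwo := fun n => v ⟨w n, hwm n⟩
  have he : Orthonormal ℝ e := hv.comp (fun n => (⟨w n, hwm n⟩ : Z)) fun m n h =>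
    hw.injective (Subtype.ext_iff.1 h)
  have hebot : (Submodule.span ℝ (Set.range e))ᗮ = ⊥ := by
    rw [Submodule.eq_bot_iff]
    intro y hy
    refine hvc y fun z => ?_
    obtain ⟨n, hn⟩ : (z : ℝ) ∈ Set.range w := by rw [hwZ]; exact z.2
    have hz : (⟨w n, hwm n⟩ : Z) = z := Subtype.ext hn
    rw [← hz]
    exact hy _ (Submodule.subset_span ⟨n, rfl⟩)
  let b := HilbertBasis.mkOfOrthogonalEqBot he hebot
  have hb : ⇑b = e := HilbertBasis.coe_mkOfOrthogonalEqBot he hebot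
  let Y : EllTwo := ⟨y, EllTwo.memℓp_of_summable_sq hy⟩
  have hsum := (b.hasSum_repr Y).tendsto_sum_nat
  rw [hb] at hsum
  let P : ℕ → EllTwo := fun N => ∑ r ∈ Finset.range N, b.repr Y r • e r
  have hP : Tendsto (fun N => ‖P N - Y‖ ^ 2) atTop (𝓝 0) := by
    simpa using ((tendsto_iff_norm_sub_tendsto_zero.1 hsum).pow 2)
  refine ⟨fun r => b.repr Y r * ‖Φ (w r)‖⁻¹, _, hP, fun N => ?_⟩
  rw [EllTwo.norm_sq]
  convert (EllTwo.summable_sq (P N - Y)).hasSum using 2 with i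
  congr 1
  change _ = P N i - y i
  congr 1
  simp only [P]
  rw [lp.coeFn_sum, Finset.sum_apply]
  refine Finset.sum_congr rfl fun r _ => ?_
  change _ = b.repr Y r * (‖Φ (w r)‖⁻¹ * Φ (w r) i)
  rw [hΦ (w r) i]
  ring

/-! ### Difference quotients on the geometric grid -/

/-- The difference quotient `(u n - u (n + 1)) / q^n` on the geometric grid. -/
noncomputable def gridDiff (q : ℝ) (u : ℕ → ℝ) (n : ℕ) : ℝ :=
  (u n - u (n + 1)) / q ^ n

theorem gridDiff_sub (u v : ℕ → ℝ) (n : ℕ) :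
    gridDiff q (fun n => u n - v n) n = gridDiff q u n - gridDiff q v n := by
  simp only [gridDiff]; ring

theorem gridDiff_gridDiff_sub (u v : ℕ → ℝ) (n : ℕ) :
    gridDiff q (gridDiff q fun n => u n - v n) n =
      gridDiff q (gridDiff q u) n - gridDiff q (gridDiff q v) n := by
  have h : (gridDiff q fun n => u n - v n) = fun n => gridDiff q u n - gridDiff q v n :=
    funext (gridDiff_sub u v)
  rw [h, gridDiff_sub]

theorem gridDiff_sum (N : ℕ) (c : ℕ → ℝ) (f : ℕ → ℕ → ℝ) (n : ℕ) :
    gridDiff q (fun n => ∑ r ∈ Finset.range N, c r * f r n) n =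
      ∑ r ∈ Finset.range N, c r * gridDiff q (f r) n := by
  simp only [gridDiff]
  rw [← Finset.sum_sub_distrib, Finset.sum_div]
  exact Finset.sum_congr rfl fun r _ => by ring

theorem gridDiff_gridDiff_sum (N : ℕ) (c : ℕ → ℝ) (f : ℕ → ℕ → ℝ) (n : ℕ) :
    gridDiff q (gridDiff q fun n => ∑ r ∈ Finset.range N, c r * f r n) n =
      ∑ r ∈ Finset.range N, c r * gridDiff q (gridDiff q (f r)) n := by
  have h : (gridDiff q fun n => ∑ r ∈ Finset.range N, c r * f r n) =
      fun n => ∑ r ∈ Finset.range N, c r * gridDiff q (f r) n :=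
    funext (gridDiff_sum N c f)
  rw [h, gridDiff_sum]

/-- The shift to `n + 1` and the factor `√q` match the entries `√q^(i+1) S_q(z q^(i+1))` of the sine
vectors. -/
theorem gridDiff_gridDiff_qSin (hq0 : 0 < q) (hq1 : q < 1) (z : ℝ) (n : ℕ) :
    gridDiff q (gridDiff q fun n => qSin q (z * q ^ n)) n =
      -(z ^ 2 * √q * qSin q (z * q ^ (n + 1))) := by
  have h := (isDecayingSolution_qSin hq0 hq1 z).recurrence n
  have hs : √q * √q = q := Real.mul_self_sqrt hq0.le
  have hs0 : √q ≠ 0 := (Real.sqrt_pos.2 hq0).ne'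
  have hdiv : z ^ 2 / √q * q = z ^ 2 * √q := by
    field_simp
    linear_combination -z ^ 2 * hs
  generalize z ^ 2 / √q = τ at h hdiv
  simp only [gridDiff]
  have hp : q ^ n ≠ 0 := (pow_pos hq0 n).ne'
  have hq := hq0.ne'
  rw [h, ← hdiv, pow_succ]
  field_simp
  ring

/-- A sequence with zero boundary values and its difference quotient are controlled by the second
difference quotient. -/
theorem gridDiff_bounds (hq0 : 0 < q) (hq1 : q < 1) {u : ℕ → ℝ} (hu0 : u 0 = 0)
    (hu : Tendsto u atTop (𝓝 0)) {B : ℝ}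
    (hB : HasSum (fun i => q ^ i * gridDiff q (gridDiff q u) i ^ 2) B) (n : ℕ) :
    gridDiff q u n ^ 2 ≤ 4 * B / (1 - q) ∧ u n ^ 2 ≤ 4 * B / (1 - q) ^ 3 := by
  have h1q : 0 < 1 - q := by linarith
  set d := gridDiff q u with hd
  have hB0 : 0 ≤ B := hB.nonneg fun i => by positivity
  have hgeom : ∀ n, ∑ i ∈ Finset.range n, q ^ i ≤ 1 / (1 - q) := fun n => by
    rw [one_div, ← tsum_geometric_of_lt_one hq0.le hq1]
    exact (summable_geometric_of_lt_one hq0.le hq1).sum_le_tsum _ fun i _ => by positivity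
  -- Cauchy–Schwarz with weights `q^i` of total mass `1 / (1 - q)` bounds the oscillation of `d` by
  -- this constant.
  set M := √(B / (1 - q)) with hM
  have hMsq : M ^ 2 = B / (1 - q) := Real.sq_sqrt (by positivity)
  have hM0 : 0 ≤ M := Real.sqrt_nonneg _
  have hdd : ∀ n, d 0 - d n = ∑ i ∈ Finset.range n, q ^ i * gridDiff q d i := fun n => by
    rw [← Finset.sum_range_sub']
    refine Finset.sum_congr rfl fun i _ => ?_
    rw [gridDiff, mul_div_cancel₀ _ (pow_pos hq0 i).ne']
  have hdM : ∀ n, |d 0 - d n| ≤ M := fun n => by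
    refine Real.abs_le_sqrt ?_
    rw [hdd]
    calc (∑ i ∈ Finset.range n, q ^ i * gridDiff q d i) ^ 2
        = (∑ i ∈ Finset.range n, √q ^ i * (√q ^ i * gridDiff q d i)) ^ 2 := by
          simp only [← mul_assoc, sqrt_pow_mul_self hq0]
      _ ≤ (∑ i ∈ Finset.range n, (√q ^ i) ^ 2) *
            ∑ i ∈ Finset.range n, (√q ^ i * gridDiff q d i) ^ 2 :=
          Finset.sum_mul_sq_le_sq_mul_sq _ _ _
      _ = (∑ i ∈ Finset.range n, q ^ i) *
            ∑ i ∈ Finset.range n, q ^ i * gridDiff q d i ^ 2 := by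
          simp only [mul_pow, sq (√q ^ _), sqrt_pow_mul_self hq0]
      _ ≤ 1 / (1 - q) * B := by
          gcongr
          · exact hgeom n
          · exact sum_le_hasSum _ (fun i _ => by positivity) hB
      _ = B / (1 - q) := by ring
  have hud : ∀ n, -u n = ∑ i ∈ Finset.range n, q ^ i * d i := fun n => by
    rw [← zero_sub, ← hu0, ← Finset.sum_range_sub']
    refine Finset.sum_congr rfl fun i _ => ?_
    rw [hd, gridDiff, mul_div_cancel₀ _ (pow_pos hq0 i).ne']
  -- Since `u` vanishes at both ends, the weighted sum of `d` tends to zero, so `d 0` is an average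
  -- of the deviations `d 0 - d i`.
  have hd0 : |d 0| ≤ M := by
    have hle : ∀ n, |d 0 * ∑ i ∈ Finset.range n, q ^ i| ≤ |u n| + M * (1 / (1 - q)) := fun n => by
      have : d 0 * ∑ i ∈ Finset.range n, q ^ i =
          -u n + ∑ i ∈ Finset.range n, q ^ i * (d 0 - d i) := by
        rw [hud, ← Finset.sum_add_distrib, Finset.mul_sum]
        exact Finset.sum_congr rfl fun i _ => by ring
      rw [this]
      refine (abs_add_le _ _).trans (add_le_add (abs_neg _).le ?_)
      refine (Finset.abs_sum_le_sum_abs _ _).trans ?_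
      calc ∑ i ∈ Finset.range n, |q ^ i * (d 0 - d i)|
          ≤ ∑ i ∈ Finset.range n, q ^ i * M := by
            refine Finset.sum_le_sum fun i _ => ?_
            rw [abs_mul, abs_of_pos (pow_pos hq0 i)]
            gcongr
            exact hdM i
        _ = M * ∑ i ∈ Finset.range n, q ^ i := by rw [← Finset.sum_mul, mul_comm]
        _ ≤ M * (1 / (1 - q)) := by gcongr; exact hgeom n
    have hl1 : Tendsto (fun n => |d 0 * ∑ i ∈ Finset.range n, q ^ i|) atTop
        (𝓝 |d 0 * (1 - q)⁻¹|) :=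
      (((hasSum_geometric_of_lt_one hq0.le hq1).tendsto_sum_nat).const_mul _).abs
    have hl2 : Tendsto (fun n => |u n| + M * (1 / (1 - q))) atTop
        (𝓝 (|0| + M * (1 / (1 - q)))) := hu.abs.add_const _
    have := le_of_tendsto_of_tendsto' hl1 hl2 hle
    rw [abs_zero, zero_add, abs_mul, abs_of_pos (inv_pos.2 h1q), one_div] at this
    exact le_of_mul_le_mul_right this (inv_pos.2 h1q)
  have hdn : ∀ n, |d n| ≤ 2 * M := fun n => by
    have h1 := abs_le.1 (hdM n)
    have h2 := abs_le.1 hd0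
    exact abs_le.2 ⟨by linarith, by linarith⟩
  have hun : |u n| ≤ 2 * M * (1 / (1 - q)) := by
    rw [← abs_neg, hud]
    refine (Finset.abs_sum_le_sum_abs _ _).trans ?_
    calc ∑ i ∈ Finset.range n, |q ^ i * d i| ≤ ∑ i ∈ Finset.range n, q ^ i * (2 * M) := by
          refine Finset.sum_le_sum fun i _ => ?_
          rw [abs_mul, abs_of_pos (pow_pos hq0 i)]
          gcongr
          exact hdn i
      _ = 2 * M * ∑ i ∈ Finset.range n, q ^ i := by rw [← Finset.sum_mul, mul_comm]
      _ ≤ 2 * M * (1 / (1 - q)) := by gcongr; exact hgeom n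
  constructor
  · calc d n ^ 2 = |d n| ^ 2 := (sq_abs _).symm
      _ ≤ (2 * M) ^ 2 := pow_le_pow_left₀ (abs_nonneg _) (hdn n) 2
      _ = 4 * B / (1 - q) := by rw [mul_pow, hMsq]; ring
  · calc u n ^ 2 = |u n| ^ 2 := (sq_abs _).symm
      _ ≤ (2 * M * (1 / (1 - q))) ^ 2 := pow_le_pow_left₀ (abs_nonneg _) hun 2
      _ = 4 * B / (1 - q) ^ 3 := by
        rw [mul_pow, mul_pow, hMsq]; field_simp; ring

/-! ### Convergence in `q`-mean -/

/-- The `q`-integral samples only nonzero grid points, so values at `0` play no part, and equal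
errors on the two halves just double the sum. -/
theorem tendstoQMean_of_hasSum {a : ℝ} {F : ℕ → ℝ → ℝ} {f : ℝ → ℝ} (e : ℕ → ℕ → ℝ)
    (hpos : ∀ N n, |F N (a * q ^ n) - f (a * q ^ n)| ^ 2 = e N n)
    (hneg : ∀ N n, |F N (-(a * q ^ n)) - f (-(a * q ^ n))| ^ 2 = e N n)
    {B : ℕ → ℝ} (hB : ∀ N, HasSum (fun n => q ^ n * e N n) (B N)) (hlim : Tendsto B atTop (𝓝 0)) :
    TendstoQMean q a F f := by
  have h1 : ∀ N, HasSum (fun n => q ^ n * |F N (a * q ^ n) - f (a * q ^ n)| ^ 2) (B N) :=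
    fun N => by simpa only [hpos] using hB N
  have h2 : ∀ N, HasSum (fun n => q ^ n * |F N (-a * q ^ n) - f (-a * q ^ n)| ^ 2) (B N) :=
    fun N => by simpa only [neg_mul, hneg] using hB N
  refine ⟨fun N => ⟨(h1 N).summable, (h2 N).summable⟩, ?_⟩
  have h3 : ∀ N, qIntegral q (-a) a (fun x => |F N x - f x| ^ 2) = 2 * (1 - q) * a * B N :=
    fun N => by
      rw [qIntegral, qIntegralZero, qIntegralZero, (h1 N).tsum_eq, (h2 N).tsum_eq]
      ring
  simp only [h3]
  simpa using (hlim.const_mul (2 * (1 - q) * a)).sqrt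

theorem tendstoQMean_of_bound (hq0 : 0 < q) (hq1 : q < 1) {a : ℝ} {F : ℕ → ℝ → ℝ} {f : ℝ → ℝ}
    (e : ℕ → ℕ → ℝ)
    (hpos : ∀ N n, |F N (a * q ^ n) - f (a * q ^ n)| ^ 2 = e N n)
    (hneg : ∀ N n, |F N (-(a * q ^ n)) - f (-(a * q ^ n))| ^ 2 = e N n)
    {B : ℕ → ℝ} (hB : ∀ N n, e N n ≤ B N) (hlim : Tendsto B atTop (𝓝 0)) :
    TendstoQMean q a F f := by
  have he : ∀ N n, 0 ≤ e N n := fun N n => by rw [← hpos]; positivity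
  have hg := fun N => (summable_geometric_of_lt_one hq0.le hq1).mul_right (B N)
  have hle : ∀ N n, q ^ n * e N n ≤ q ^ n * B N := fun N n => by gcongr; exact hB N n
  have hs : ∀ N, Summable fun n => q ^ n * e N n := fun N =>
    Summable.of_nonneg_of_le (fun n => mul_nonneg (by positivity) (he N n)) (hle N) (hg N)
  refine tendstoQMean_of_hasSum e hpos hneg (fun N => (hs N).hasSum) ?_
  refine squeeze_zero (fun N => tsum_nonneg fun n => mul_nonneg (by positivity) (he N n))
    (fun N => (hs N).tsum_le_tsum (hle N) (hg N)) ?_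
  simp only [tsum_mul_right]
  simpa using hlim.const_mul (∑' n : ℕ, q ^ n)

theorem qDeriv_grid (hq0 : 0 < q) {a : ℝ} (ha : 0 < a) (f : ℝ → ℝ) (n : ℕ) :
    qDeriv q f (a * q ^ n) = gridDiff q (fun n => f (a * q ^ n)) n / ((1 - q) * a) := by
  have h0 : a * q ^ n ≠ 0 := by positivity
  rw [qDeriv, if_neg h0, gridDiff, div_div, show q * (a * q ^ n) = a * q ^ (n + 1) by ring]
  congr 1
  ring

theorem qDeriv_grid_neg (hq0 : 0 < q) {a : ℝ} (ha : 0 < a) (f : ℝ → ℝ) (n : ℕ) :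
    qDeriv q f (-(a * q ^ n)) = -(gridDiff q (fun n => f (-(a * q ^ n))) n / ((1 - q) * a)) := by
  have h0 : -(a * q ^ n) ≠ 0 := neg_ne_zero.2 (by positivity)
  rw [qDeriv, if_neg h0, gridDiff, div_div, show q * -(a * q ^ n) = -(a * q ^ (n + 1)) by ring,
    ← div_neg]
  congr 1
  ring

theorem gridDiff_neg (u : ℕ → ℝ) (n : ℕ) : gridDiff q (fun n => -u n) n = -gridDiff q u n := by
  simp only [gridDiff]; ring

theorem gridDiff_div_const (u : ℕ → ℝ) (c : ℝ) (n : ℕ) :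
    gridDiff q (fun n => u n / c) n = gridDiff q u n / c := by
  simp only [gridDiff]; ring

/-- The `q`-derivative turns odd into even, so squared errors agree on the two halves of the grid.
-/
theorem qDeriv_grid_neg_of_odd (hq0 : 0 < q) {a : ℝ} (ha : 0 < a) {f : ℝ → ℝ}
    (hf : ∀ n : ℕ, f (-(a * q ^ n)) = -f (a * q ^ n)) (n : ℕ) :
    qDeriv q f (-(a * q ^ n)) = gridDiff q (fun n => f (a * q ^ n)) n / ((1 - q) * a) := by
  rw [qDeriv_grid_neg hq0 ha]
  simp only [hf, gridDiff_neg]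
  ring

theorem qDeriv_qDeriv_grid (hq0 : 0 < q) {a : ℝ} (ha : 0 < a) (f : ℝ → ℝ) (n : ℕ) :
    qDeriv q (qDeriv q f) (a * q ^ n) =
      gridDiff q (gridDiff q fun n => f (a * q ^ n)) n / ((1 - q) * a) ^ 2 := by
  rw [qDeriv_grid hq0 ha]
  simp only [qDeriv_grid hq0 ha, gridDiff_div_const]
  rw [div_div, ← sq]

theorem qDeriv_qDeriv_grid_neg_of_odd (hq0 : 0 < q) {a : ℝ} (ha : 0 < a) {f : ℝ → ℝ}
    (hf : ∀ n : ℕ, f (-(a * q ^ n)) = -f (a * q ^ n)) (n : ℕ) :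
    qDeriv q (qDeriv q f) (-(a * q ^ n)) =
      -(gridDiff q (gridDiff q fun n => f (a * q ^ n)) n / ((1 - q) * a) ^ 2) := by
  rw [qDeriv_grid_neg hq0 ha]
  simp only [qDeriv_grid_neg_of_odd hq0 ha hf, gridDiff_div_const]
  rw [div_div, ← sq]

/-- For functions that are odd on the grid and vanish at `a` and (in the limit) at `0`,
`q`-mean convergence of the second `q`-derivatives entails that of the functions and of the first
`q`-derivatives. -/
theorem tendstoQMean_iterate_qDeriv (hq0 : 0 < q) (hq1 : q < 1) {a : ℝ} (ha : 0 < a)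
    {F : ℕ → ℝ → ℝ} {f : ℝ → ℝ}
    (hF : ∀ N, ∀ n : ℕ, F N (-(a * q ^ n)) = -F N (a * q ^ n))
    (hf : ∀ n : ℕ, f (-(a * q ^ n)) = -f (a * q ^ n))
    (hFa : ∀ N, F N a = 0) (hfa : f a = 0)
    (hF0 : ∀ N, Tendsto (fun n : ℕ => F N (a * q ^ n)) atTop (𝓝 0))
    (hf0 : Tendsto (fun n : ℕ => f (a * q ^ n)) atTop (𝓝 0))
    {B : ℕ → ℝ} (hlim : Tendsto B atTop (𝓝 0))
    (hB : ∀ N, HasSum (fun i => q ^ i * (gridDiff q (gridDiff q fun n => F N (a * q ^ n)) i -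
      gridDiff q (gridDiff q fun n => f (a * q ^ n)) i) ^ 2) (B N))
    (k : ℕ) (hk : k ≤ 2) :
    TendstoQMean q a (fun N => (qDeriv q)^[k] (F N)) ((qDeriv q)^[k] f) := by
  have hbd := fun N => gridDiff_bounds hq0 hq1 (u := fun n => F N (a * q ^ n) - f (a * q ^ n))
    (by simp [hFa, hfa]) (by simpa using (hF0 N).sub hf0)
    (by simpa only [gridDiff_gridDiff_sub] using hB N)
  simp only [gridDiff_sub] at hbd
  have hl : ∀ c : ℝ, Tendsto (fun N => 4 * B N / c) atTop (𝓝 0) := fun c => by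
    simpa using (hlim.const_mul 4).div_const c
  interval_cases k
  · refine tendstoQMean_of_bound hq0 hq1 (fun N n => (F N (a * q ^ n) - f (a * q ^ n)) ^ 2)
      (fun N n => sq_abs _) (fun N n => ?_) (fun N n => (hbd N n).2) (hl _)
    simp only [Function.iterate_zero, id]
    rw [sq_abs, hF, hf]
    ring
  · refine tendstoQMean_of_bound hq0 hq1 (fun N n => (gridDiff q (fun n => F N (a * q ^ n)) n -
        gridDiff q (fun n => f (a * q ^ n)) n) ^ 2 / ((1 - q) * a) ^ 2)
      (fun N n => ?_) (fun N n => ?_) (fun N n => ?_) (by simpa using (hl (1 - q)).div_const (((1 - q) * a) ^ 2))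
    · simp only [Function.iterate_one]
      rw [sq_abs, qDeriv_grid hq0 ha, qDeriv_grid hq0 ha, ← sub_div, div_pow]
    · simp only [Function.iterate_one]
      rw [sq_abs, qDeriv_grid_neg_of_odd hq0 ha (hF N), qDeriv_grid_neg_of_odd hq0 ha hf,
        ← sub_div, div_pow]
    · exact div_le_div_of_nonneg_right (hbd N n).1 (sq_nonneg _)
  · refine tendstoQMean_of_hasSum (fun N n =>
        (gridDiff q (gridDiff q fun n => F N (a * q ^ n)) n -
          gridDiff q (gridDiff q fun n => f (a * q ^ n)) n) ^ 2 / (((1 - q) * a) ^ 2) ^ 2)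
      (fun N n => ?_) (fun N n => ?_)
      (fun N => by simpa only [mul_div_assoc] using (hB N).div_const ((((1 - q) * a) ^ 2) ^ 2))
      (by simpa using hlim.div_const _)
    · simp only [Function.iterate_succ, Function.iterate_zero, Function.comp, id]
      rw [sq_abs, qDeriv_qDeriv_grid hq0 ha, qDeriv_qDeriv_grid hq0 ha, ← sub_div, div_pow]
    · simp only [Function.iterate_succ, Function.iterate_zero, Function.comp, id]
      rw [sq_abs, qDeriv_qDeriv_grid_neg_of_odd hq0 ha (hF N),
        qDeriv_qDeriv_grid_neg_of_odd hq0 ha hf, ← neg_sub', neg_sq, ← sub_div, div_pow]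

theorem grid_mem (q a : ℝ) (n : ℕ) : a * q ^ n ∈ grid q a := Or.inr ⟨n, Or.inl rfl⟩

theorem tendsto_grid (hq0 : 0 < q) (hq1 : q < 1) (a : ℝ) :
    Tendsto (fun n : ℕ => a * q ^ n) atTop (𝓝 0) := by
  simpa using (tendsto_pow_atTop_nhds_zero_of_lt_one hq0.le hq1).const_mul a

/-- The second difference quotients of a function whose second `q`-derivative is continuous near
zero are square-summable against the weights `q^n`. -/
theorem summable_gridDiff_gridDiff_sq (hq0 : 0 < q) (hq1 : q < 1) {a : ℝ} (ha : 0 < a) {g : ℝ → ℝ}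
    (hg : ContinuousPiecewiseSmoothNearZero ((qDeriv q)^[2] g)) :
    Summable fun i => (√q ^ i * gridDiff q (gridDiff q fun n => g (a * q ^ n)) i) ^ 2 := by
  have h1q : 0 < 1 - q := by linarith
  obtain ⟨δ, hδ, hc, -⟩ := hg
  have hcont : ContinuousAt ((qDeriv q)^[2] g) 0 :=
    hc.continuousAt (Ioo_mem_nhds (by linarith) hδ)
  have hlim := (hcont.tendsto.comp (tendsto_grid hq0 hq1 a)).const_mul (((1 - q) * a) ^ 2)
  have heq : ∀ n : ℕ, ((1 - q) * a) ^ 2 * ((qDeriv q)^[2] g ∘ fun n : ℕ => a * q ^ n) n =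
      gridDiff q (gridDiff q fun n => g (a * q ^ n)) n := fun n => by
    simp only [Function.iterate_succ, Function.iterate_zero, Function.comp, id]
    rw [qDeriv_qDeriv_grid hq0 ha, mul_div_cancel₀ _ (by positivity)]
  simp only [heq] at hlim
  -- Only boundedness of the convergent sequence is used; the value of its limit is irrelevant.
  obtain ⟨C, hC⟩ := (hlim.pow 2).bddAbove_range
  refine Summable.of_nonneg_of_le (fun i => sq_nonneg _) (fun i => ?_)
    ((summable_geometric_of_lt_one hq0.le hq1).mul_right C)
  rw [mul_pow, sq (√q ^ i), sqrt_pow_mul_self hq0]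
  gcongr
  exact hC ⟨i, rfl⟩

end

end QFourier

/-! ### The expansion theorem -/

theorem mainTheorem7 (q : ℝ) (hq0 : 0 < q) (hq1 : q < 1) (a : ℝ) (ha : 0 < a) :
    ∃ w : ℕ → ℝ, StrictMono w ∧ Set.range w = {z : ℝ | 0 < z ∧ QFourier.qSin q z = 0} ∧
      ∀ g : ℝ → ℝ,
        QFourier.QRegularAtZero q (QFourier.grid q a) g →
        (∀ x ∈ QFourier.grid q a, g (-x) = -g x) →
        (∀ k : ℕ, k ≤ 2 →
          QFourier.ContinuousPiecewiseSmoothNearZero ((QFourier.qDeriv q)^[k] g)) →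
        g 0 = 0 → g a = 0 →
        ∃ c : ℕ → ℝ, ∀ k : ℕ, k ≤ 2 →
          QFourier.TendstoQMean q a
            (fun n => (QFourier.qDeriv q)^[k]
              (fun x => ∑ r ∈ Finset.range n, c r * QFourier.qSin q (w r * x / a)))
            ((QFourier.qDeriv q)^[k] g) := by
  obtain ⟨w, hw, hwZ, hbasis⟩ := QFourier.exists_sine_basis hq0 hq1
  refine ⟨w, hw, hwZ, fun g hreg hodd hsmooth hg0 hga => ?_⟩
  have hwm : ∀ r, 0 < w r ∧ QFourier.qSin q (w r) = 0 := fun r => by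
    have : w r ∈ Set.range w := ⟨r, rfl⟩
    rwa [hwZ] at this
  -- The sequence expanded is the weighted second difference quotient of `g`.
  obtain ⟨b, B, hB0, hB⟩ := hbasis _
    (QFourier.summable_gridDiff_gridDiff_sq hq0 hq1 ha (hsmooth 2 le_rfl))
  have harg : ∀ r (n : ℕ), w r * (a * q ^ n) / a = w r * q ^ n := fun r n => by field_simp
  have hzero : ∀ r, Tendsto (fun n : ℕ => QFourier.qSin q (w r * q ^ n)) atTop (𝓝 0) := fun r => by
    obtain ⟨C, hC⟩ := (QFourier.isDecayingSolution_qSin hq0 hq1 (w r)).bound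
    exact squeeze_zero_norm hC (QFourier.tendsto_grid hq0 hq1 C)
  -- The second difference quotient of the `r`-th mode carries the factor `-w_r² √q`; the `√q` is
  -- absorbed into the weight `√q^(i+1)`.
  refine ⟨fun r => -b r / w r ^ 2, fun k hk => ?_⟩
  refine QFourier.tendstoQMean_iterate_qDeriv hq0 hq1 ha (fun N n => ?_)
    (fun n => hodd _ (QFourier.grid_mem q a n)) (fun N => ?_) hga (fun N => ?_) ?_ hB0
    (fun N => ?_) k hk
  · rw [← Finset.sum_neg_distrib]
    refine Finset.sum_congr rfl fun r _ => ?_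
    rw [mul_neg, neg_div, QFourier.qSin_neg, mul_neg]
  · refine Finset.sum_eq_zero fun r _ => ?_
    rw [mul_div_cancel_right₀ _ ha.ne', (hwm r).2, mul_zero]
  · simp only [harg]
    simpa using tendsto_finsetSum (Finset.range N) fun r _ =>
      (hzero r).const_mul (-b r / w r ^ 2)
  · have := hreg a (by simpa using QFourier.grid_mem q a 0)
    rwa [hg0] at this
  · simp only [harg]
    convert hB N using 2 with i
    rw [QFourier.gridDiff_gridDiff_sum, ← QFourier.sqrt_pow_mul_self hq0 i, ← sq, ← mul_pow,
      mul_sub, Finset.mul_sum]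
    congr 2
    refine Finset.sum_congr rfl fun r _ => ?_
    rw [QFourier.gridDiff_gridDiff_qSin hq0 hq1]
    have := (hwm r).1.ne'
    field_simp
    ring
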